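/- Let $d\ge 1$. For a probability measure $G$ on $\mathbb{R}^d$ let $f_G(x)=\int \phi_d(x-\theta)\,dG(\theta)$, where $\phi_d(z)=(2\pi)^{-d/2}\exp(-\|z\|^2/2)$, and let $\mathcal{M}$ be the class of all densities $f_G$, with $G$ ranging over all probability measures on $\mathbb{R}^d$. For densities $f,g$ write $\mathfrak{H}^2(f,g)=\int(\sqrt{f(x)}-\sqrt{g(x)})^2\,dx$. Theorem (near parametric risk for discrete Gaussian mixtures). There exists a constant $C_d>0$, depending only on $d$, such that the following holds for every $n\ge 2$. Let $G_1,\dots,G_n$ be probability measures on $\mathbb{R}^d$, let $X_1,\dots,X_n$ be independent random vectors such that $X_i$ has density $f_{G_i}$, and let $\bar G_n=(G_1+\dots+G_n)/n$. Let $\hat f_n$ be any nonparametric maximum likelihood estimator based on $X_1,\dots,X_n$, i.e. any maximizer of $f\mapsto \frac1n\sum_{i=1}^n\log f(X_i)$ over $f\in\mathcal{M}$. If $k$ is a positive integer and $\bar G_n$ is a discrete probability measure supported on a set of cardinality $k$, then $$\mathbb{E}\,\mathfrak{H}^2(\hat f_n,f_{\bar G_n})\le C_d\,\frac{k}{n}\,(\log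 n)^{d+1}.$$ -/

import Mathlib

open MeasureTheory ProbabilityTheory

namespace GaussianNPMLE

noncomputable section

/-- The standard `d`-dimensional normal density `φ_d(z) = (2π)^{-d/2} exp(-‖z‖²/2)`. -/
def gaussianDensity (d : ℕ) (z : EuclideanSpace ℝ (Fin d)) : ℝ :=
  (2 * Real.pi) ^ (-(d : ℝ) / 2) * Real.exp (-‖z‖ ^ 2 / 2)

/-- The Gaussian location mixture density `f_G(x) = ∫ φ_d(x - θ) dG(θ)` with mixing measure `G`. -/
def mixtureDensity {d : ℕ} (G : Measure (EuclideanSpace ℝ (Fin d)))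
    (x : EuclideanSpace ℝ (Fin d)) : ℝ :=
  ∫ θ, gaussianDensity d (x - θ) ∂G

/-- The law on `ℝ^d` whose Lebesgue density is `f_G`. -/
def mixtureLaw {d : ℕ} (G : Measure (EuclideanSpace ℝ (Fin d))) :
    Measure (EuclideanSpace ℝ (Fin d)) :=
  volume.withDensity fun x => ENNReal.ofReal (mixtureDensity G x)

/-- The class of all Gaussian location mixture densities `f_G`, as `G` ranges over all probability
measures on `ℝ^d`. -/
def mixtureClass (d : ℕ) : Set (EuclideanSpace ℝ (Fin d) → ℝ) :=
  {f | ∃ G : Measure (EuclideanSpace ℝ (Fin d)), IsProbabilityMeasure G ∧ f = mixtureDensity G}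

/-- `f` is a nonparametric maximum likelihood estimate for the data points `x₁, …, x_n`: it
maximizes `(1/n) ∑ log f(x_i)` over the class of all Gaussian location mixture densities. -/
def IsNPMLE {d n : ℕ} (x : Fin n → EuclideanSpace ℝ (Fin d))
    (f : EuclideanSpace ℝ (Fin d) → ℝ) : Prop :=
  f ∈ mixtureClass d ∧
    IsMaxOn (fun g : EuclideanSpace ℝ (Fin d) → ℝ => (1 / (n : ℝ)) * ∑ i, Real.log (g (x i)))
      (mixtureClass d) f

/-- The squared Hellinger distance `∫ (√f(x) - √g(x))² dx`, as an extended nonnegative real. -/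
def hellingerSq {d : ℕ} (f g : EuclideanSpace ℝ (Fin d) → ℝ) : ENNReal :=
  ∫⁻ x, ENNReal.ofReal ((√(f x) - √(g x)) ^ 2)

/-- The average `(G₁ + ⋯ + G_n) / n` of measures on `ℝ^d`. -/
def averageMeasure {d n : ℕ} (G : Fin n → Measure (EuclideanSpace ℝ (Fin d))) :
    Measure (EuclideanSpace ℝ (Fin d)) :=
  (n : ENNReal)⁻¹ • ∑ i, G i

end

end GaussianNPMLE

/-! The likelihood of a maximizer `f_H` at the data is at least that of `f_Ḡ`, where `Ḡ` is the
average mixing measure. If `f_H` is at squared Hellinger distance at least `τ` from `f_Ḡ`, replace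
`H` by a data-free representative `H'` of one of finitely many classes, also at distance at least
`τ`, with `f_H ≤ f_{H'} + η` on a neighbourhood `B` of the support `S`. If all data lie in `B`, then
`∏ √((f_{H'} + η)/f_Ḡ)(X_i) ≥ 1`. By independence, `a ≤ e^{a-1}` and `∑ f_{G_i} = n f_Ḡ`, this
product has mean at most `exp(1 - nτ/2)` (`lintegral_prod_rootLikelihoodRatio_le`). A union bound
over the classes gives the risk bound (`lintegral_hellingerSq_isNPMLE_le`).

The rate comes from counting classes. Near an atom `s`, `f_H` is determined up to error `e^{3r/2}
2^{-m}` by `m^d` bounded moments, whatever `H` is, since the kernel expansion converges uniformly in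
`θ`. With `r` and `m` of order `log n` and moments rounded to precision `n^{-q}`, the number of
classes has logarithm of order `k (log n)^{d+1}`. Data leave `B` with probability at most `1/n`,
because every `G_i` also lives on `S`. -/

namespace GaussianNPMLE

/-! ### Expansion of the Gaussian kernel -/

/-- The functions `e^{-t²/2} t^a / √(a!)`, which factor the Gaussian kernel:
`∑ₐ bₐ(u) bₐ(v) = e^{-(u-v)²/2}`. -/
noncomputable def expBasis (a : ℕ) (t : ℝ) : ℝ :=
  Real.exp (-t ^ 2 / 2) * t ^ a / √(a.factorial)

theorem expBasis_sq (a : ℕ) (t : ℝ) :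
    expBasis a t ^ 2 = Real.exp (-t ^ 2) * ((t ^ 2) ^ a / a.factorial) := by
  unfold expBasis
  rw [div_pow, mul_pow, Real.sq_sqrt (by positivity), ← Real.exp_nat_mul, ← pow_mul, ← pow_mul,
    mul_comm a 2, mul_div_assoc]
  congr 2
  push_cast; ring

/-- Up to the factor `e^{-t²}`, this is a partial sum of the series of `e^{t²}`. Cauchy–Schwarz then
bounds every truncated kernel by 1. -/
theorem sum_expBasis_sq_le_one (m : ℕ) (t : ℝ) :
    ∑ a ∈ Finset.range m, expBasis a t ^ 2 ≤ 1 := by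
  simp_rw [expBasis_sq, ← Finset.mul_sum]
  calc _ ≤ Real.exp (-t ^ 2) * Real.exp (t ^ 2) := by
        gcongr
        exact Real.sum_le_exp_of_nonneg (sq_nonneg t) m
    _ = 1 := by rw [← Real.exp_add]; simp

theorem abs_expBasis_le_one (a : ℕ) (t : ℝ) : |expBasis a t| ≤ 1 := by
  rw [← sq_le_one_iff_abs_le_one]
  exact (Finset.single_le_sum (f := fun a => expBasis a t ^ 2) (fun _ _ => sq_nonneg _)
    (Finset.self_mem_range_succ a)).trans (sum_expBasis_sq_le_one (a + 1) t)

theorem abs_sum_expBasis_mul_le_one (m : ℕ) (u v : ℝ) :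
    |∑ a ∈ Finset.range m, expBasis a u * expBasis a v| ≤ 1 := by
  rw [← sq_le_one_iff_abs_le_one]
  exact (Finset.sum_mul_sq_le_sq_mul_sq _ _ _).trans (mul_le_one₀ (sum_expBasis_sq_le_one m u)
    (Finset.sum_nonneg fun _ _ => sq_nonneg _) (sum_expBasis_sq_le_one m v))

/-- Rescaling gives `b_a(t) = e^{3t²/2} 2^{-a} b_a(2t)`, and the last factor is at most 1. -/
theorem abs_expBasis_le_geometric (a : ℕ) (t : ℝ) :
    |expBasis a t| ≤ Real.exp (3 * t ^ 2 / 2) * (1 / 2) ^ a := by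
  have h : expBasis a t = Real.exp (3 * t ^ 2 / 2) * (1 / 2) ^ a * expBasis a (2 * t) := by
    unfold expBasis
    have : Real.exp (-t ^ 2 / 2) = Real.exp (3 * t ^ 2 / 2) * Real.exp (-(2 * t) ^ 2 / 2) := by
      rw [← Real.exp_add]; congr 1; ring
    have h2 : t ^ a = (1 / 2 : ℝ) ^ a * (2 * t) ^ a := by rw [← mul_pow]; congr 1; ring
    rw [this, h2]; ring
  rw [h, abs_mul, abs_of_nonneg (by positivity)]
  exact mul_le_of_le_one_right (by positivity) (abs_expBasis_le_one a _)

theorem hasSum_expBasis_mul (u v : ℝ) :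
    HasSum (fun a => expBasis a u * expBasis a v) (Real.exp (-(u - v) ^ 2 / 2)) := by
  have h := (NormedSpace.expSeries_div_hasSum_exp (u * v)).mul_left
    (Real.exp (-u ^ 2 / 2) * Real.exp (-v ^ 2 / 2))
  rw [← Real.exp_eq_exp_ℝ, ← Real.exp_add, ← Real.exp_add] at h
  convert! h using 1
  · funext a
    have hs : √(a.factorial : ℝ) ^ 2 = a.factorial := Real.sq_sqrt (by positivity)
    unfold expBasis
    rw [Real.exp_add, mul_pow]
    calc _ = Real.exp (-u ^ 2 / 2) * Real.exp (-v ^ 2 / 2) * (u ^ a * v ^ a)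
          / √(a.factorial : ℝ) ^ 2 := by ring
      _ = _ := by rw [hs]; ring
  · congr 1; ring

/-- The geometric decay is taken from `u` alone and `v` enters only through `|b_a(v)| ≤ 1`. With `v
= θ - s`, this is why the mixing measure never has to be truncated. -/
theorem abs_sum_expBasis_mul_sub_le (m : ℕ) (u v : ℝ) :
    |∑ a ∈ Finset.range m, expBasis a u * expBasis a v - Real.exp (-(u - v) ^ 2 / 2)|
      ≤ 2 * Real.exp (3 * u ^ 2 / 2) * (1 / 2) ^ m := by
  have h := norm_sub_le_of_geometric_bound_of_hasSum (r := 1 / 2) (C := Real.exp (3 * u ^ 2 / 2))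
    (by norm_num) (fun a => ?_) (hasSum_expBasis_mul u v) m
  · rw [Real.norm_eq_abs] at h
    refine h.trans (le_of_eq ?_)
    ring
  · rw [Real.norm_eq_abs, abs_mul]
    exact (mul_le_of_le_one_right (abs_nonneg _) (abs_expBasis_le_one a v)).trans
      (abs_expBasis_le_geometric a u)

/-- Telescoping: factors are exchanged one at a time. It carries the one-dimensional truncation
error to `d` coordinates. -/
theorem abs_prod_sub_prod_le {ι : Type*} (s : Finset ι) (f g : ι → ℝ)
    (hf : ∀ i ∈ s, |f i| ≤ 1) (hg : ∀ i ∈ s, |g i| ≤ 1) :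
    |∏ i ∈ s, f i - ∏ i ∈ s, g i| ≤ ∑ i ∈ s, |f i - g i| := by
  classical
  induction s using Finset.induction_on with
  | empty => simp
  | insert a s ha ih =>
    rw [Finset.prod_insert ha, Finset.prod_insert ha, Finset.sum_insert ha]
    have ih' := ih (fun i hi => hf i (Finset.mem_insert_of_mem hi))
      (fun i hi => hg i (Finset.mem_insert_of_mem hi))
    have h1 : |∏ i ∈ s, f i| ≤ 1 := by
      rw [Finset.abs_prod]
      exact Finset.prod_le_one (fun _ _ => abs_nonneg _)
        fun i hi => hf i (Finset.mem_insert_of_mem hi)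
    have e : f a * ∏ i ∈ s, f i - g a * ∏ i ∈ s, g i
        = (f a - g a) * ∏ i ∈ s, f i + g a * (∏ i ∈ s, f i - ∏ i ∈ s, g i) := by ring
    rw [e]
    refine (abs_add_le _ _).trans ?_
    rw [abs_mul, abs_mul]
    exact add_le_add (mul_le_of_le_one_right (abs_nonneg _) h1)
      ((mul_le_of_le_one_left (abs_nonneg _) (hg a (Finset.mem_insert_self a s))).trans ih')

/-- Tensor products of the functions `expBasis`. -/
noncomputable def prodBasis {d m : ℕ} (α : Fin d → Fin m) (u : EuclideanSpace ℝ (Fin d)) : ℝ :=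
  ∏ i, expBasis (α i) (u i)

theorem abs_prodBasis_le_one {d m : ℕ} (α : Fin d → Fin m) (u : EuclideanSpace ℝ (Fin d)) :
    |prodBasis α u| ≤ 1 := by
  rw [prodBasis, Finset.abs_prod]
  exact Finset.prod_le_one (fun _ _ => abs_nonneg _) fun i _ => abs_expBasis_le_one _ _

theorem continuous_prodBasis {d m : ℕ} (α : Fin d → Fin m) :
    Continuous (prodBasis α : EuclideanSpace ℝ (Fin d) → ℝ) := by
  unfold prodBasis expBasis
  fun_prop

theorem abs_sum_prodBasis_sub_le {d : ℕ} (m : ℕ) (u v : EuclideanSpace ℝ (Fin d)) :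
    |∑ α : Fin d → Fin m, prodBasis α u * prodBasis α v - Real.exp (-‖u - v‖ ^ 2 / 2)|
      ≤ 2 * d * Real.exp (3 * ‖u‖ ^ 2 / 2) * (1 / 2) ^ m := by
  have h1 : ∑ α : Fin d → Fin m, prodBasis α u * prodBasis α v
      = ∏ i, ∑ a ∈ Finset.range m, expBasis a (u i) * expBasis a (v i) := by
    simp_rw [Finset.sum_range, Finset.prod_univ_sum, Fintype.piFinset_univ, prodBasis,
      Finset.prod_mul_distrib]
  have h2 : Real.exp (-‖u - v‖ ^ 2 / 2) = ∏ i, Real.exp (-(u i - v i) ^ 2 / 2) := by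
    rw [← Real.exp_sum, EuclideanSpace.norm_sq_eq]
    simp [Finset.sum_div, neg_div, sq_abs]
  rw [h1, h2]
  refine (abs_prod_sub_prod_le _ _ _ (fun i _ => abs_sum_expBasis_mul_le_one _ _ _)
    (fun i _ => ?_)).trans ?_
  · rw [abs_of_pos (Real.exp_pos _), Real.exp_le_one_iff]
    nlinarith [sq_nonneg (u i - v i)]
  · have hi : ∀ i ∈ Finset.univ, |∑ a ∈ Finset.range m, expBasis a (u i) * expBasis a (v i)
        - Real.exp (-(u i - v i) ^ 2 / 2)| ≤ 2 * Real.exp (3 * ‖u‖ ^ 2 / 2) * (1 / 2) ^ m := by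
      intro i _
      refine (abs_sum_expBasis_mul_sub_le m _ _).trans ?_
      have : u i ^ 2 ≤ ‖u‖ ^ 2 := by
        rw [← sq_abs, ← Real.norm_eq_abs]
        gcongr
        exact PiLp.norm_apply_le u i
      gcongr
    refine (Finset.sum_le_card_nsmul _ _ _ hi).trans (le_of_eq ?_)
    simp only [Finset.card_univ, Fintype.card_fin, nsmul_eq_mul]
    ring

/-! ### Mixture densities and their local moments -/

variable {d : ℕ}

theorem gaussianDensity_pos (z : EuclideanSpace ℝ (Fin d)) : 0 < gaussianDensity d z := by
  unfold gaussianDensity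
  positivity

theorem continuous_gaussianDensity : Continuous (gaussianDensity d) := by
  unfold gaussianDensity
  fun_prop

theorem two_pi_rpow_le_one : (2 * Real.pi) ^ (-(d : ℝ) / 2) ≤ 1 := by
  refine Real.rpow_le_one_of_one_le_of_nonpos (by linarith [Real.pi_gt_three]) ?_
  have : (0 : ℝ) ≤ d := by positivity
  linarith

theorem gaussianDensity_le_one (z : EuclideanSpace ℝ (Fin d)) : gaussianDensity d z ≤ 1 := by
  unfold gaussianDensity
  refine mul_le_one₀ two_pi_rpow_le_one (Real.exp_pos _).le (Real.exp_le_one_iff.2 ?_)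
  nlinarith [sq_nonneg ‖z‖]

theorem integrable_gaussianDensity_sub (G : Measure (EuclideanSpace ℝ (Fin d)))
    [IsFiniteMeasure G] (x : EuclideanSpace ℝ (Fin d)) :
    Integrable (fun θ => gaussianDensity d (x - θ)) G := by
  refine Integrable.of_bound (C := 1) ?_ (Filter.Eventually.of_forall fun θ => ?_)
  · exact (continuous_gaussianDensity.comp (by fun_prop)).aestronglyMeasurable
  · rw [Real.norm_eq_abs, abs_of_pos (gaussianDensity_pos _)]
    exact gaussianDensity_le_one _

theorem integrable_prodBasis_sub {m : ℕ} (G : Measure (EuclideanSpace ℝ (Fin d)))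
    [IsFiniteMeasure G] (s : EuclideanSpace ℝ (Fin d)) (α : Fin d → Fin m) :
    Integrable (fun θ => prodBasis α (θ - s)) G := by
  refine Integrable.of_bound (C := 1) ?_ (Filter.Eventually.of_forall fun θ => ?_)
  · exact ((continuous_prodBasis α).comp (by fun_prop)).aestronglyMeasurable
  · exact abs_prodBasis_le_one _ _

/-- The generalized moments of `G` about `s` which determine `f_G` near `s`. -/
noncomputable def localMoment {m : ℕ} (G : Measure (EuclideanSpace ℝ (Fin d)))
    (s : EuclideanSpace ℝ (Fin d)) (α : Fin d → Fin m) : ℝ :=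
  ∫ θ, prodBasis α (θ - s) ∂G

theorem abs_localMoment_le_one {m : ℕ} (G : Measure (EuclideanSpace ℝ (Fin d)))
    [IsProbabilityMeasure G] (s : EuclideanSpace ℝ (Fin d)) (α : Fin d → Fin m) :
    |localMoment G s α| ≤ 1 := by
  have := norm_integral_le_of_norm_le_const (μ := G) (C := 1)
    (f := fun θ => prodBasis α (θ - s)) (Filter.Eventually.of_forall fun θ =>
      abs_prodBasis_le_one α (θ - s))
  simpa [localMoment] using this

theorem abs_sum_localMoment_sub_mixtureDensity_le (m : ℕ)
    (G : Measure (EuclideanSpace ℝ (Fin d))) [IsProbabilityMeasure G]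
    (s x : EuclideanSpace ℝ (Fin d)) :
    |(2 * Real.pi) ^ (-(d : ℝ) / 2) * ∑ α : Fin d → Fin m, prodBasis α (x - s) * localMoment G s α
        - mixtureDensity G x| ≤ 2 * d * Real.exp (3 * ‖x - s‖ ^ 2 / 2) * (1 / 2) ^ m := by
  have h1 : (2 * Real.pi) ^ (-(d : ℝ) / 2) *
      ∑ α : Fin d → Fin m, prodBasis α (x - s) * localMoment G s α
      = ∫ θ, (2 * Real.pi) ^ (-(d : ℝ) / 2) *
        ∑ α : Fin d → Fin m, prodBasis α (x - s) * prodBasis α (θ - s) ∂G := by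
    rw [integral_const_mul, integral_finsetSum _ fun α _ =>
      (integrable_prodBasis_sub G s α).const_mul _]
    simp_rw [integral_const_mul, localMoment]
  rw [h1, mixtureDensity, ← integral_sub ?_ (integrable_gaussianDensity_sub G x)]
  · have hb : ∀ θ, ‖(2 * Real.pi) ^ (-(d : ℝ) / 2) *
        ∑ α : Fin d → Fin m, prodBasis α (x - s) * prodBasis α (θ - s) - gaussianDensity d (x - θ)‖
        ≤ 2 * d * Real.exp (3 * ‖x - s‖ ^ 2 / 2) * (1 / 2) ^ m := by
      intro θ
      have h := abs_sum_prodBasis_sub_le m (x - s) (θ - s)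
      rw [sub_sub_sub_cancel_right] at h
      rw [gaussianDensity, ← mul_sub, norm_mul, Real.norm_eq_abs, Real.norm_eq_abs,
        abs_of_pos (by positivity)]
      exact (mul_le_of_le_one_left (abs_nonneg _) two_pi_rpow_le_one).trans h
    have := norm_integral_le_of_norm_le_const (μ := G) (Filter.Eventually.of_forall hb)
    simpa using this
  · exact (integrable_finsetSum _ fun α _ =>
      (integrable_prodBasis_sub G s α).const_mul _).const_mul _

theorem abs_mixtureDensity_sub_le_of_localMoment (m : ℕ) {δ : ℝ}
    (G G' : Measure (EuclideanSpace ℝ (Fin d))) [IsProbabilityMeasure G] [IsProbabilityMeasure G']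
    (s x : EuclideanSpace ℝ (Fin d))
    (h : ∀ α : Fin d → Fin m, |localMoment G s α - localMoment G' s α| ≤ δ) :
    |mixtureDensity G x - mixtureDensity G' x|
      ≤ 4 * d * Real.exp (3 * ‖x - s‖ ^ 2 / 2) * (1 / 2) ^ m + m ^ d * δ := by
  have h1 := abs_sum_localMoment_sub_mixtureDensity_le m G s x
  have h2 := abs_sum_localMoment_sub_mixtureDensity_le m G' s x
  have h3 : |(2 * Real.pi) ^ (-(d : ℝ) / 2) *
        ∑ α : Fin d → Fin m, prodBasis α (x - s) * localMoment G s α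
      - (2 * Real.pi) ^ (-(d : ℝ) / 2) *
        ∑ α : Fin d → Fin m, prodBasis α (x - s) * localMoment G' s α| ≤ m ^ d * δ := by
    rw [← mul_sub, ← Finset.sum_sub_distrib, abs_mul, abs_of_pos (by positivity)]
    refine (mul_le_of_le_one_left (abs_nonneg _) two_pi_rpow_le_one).trans ?_
    refine (Finset.abs_sum_le_sum_abs _ _).trans ?_
    refine (Finset.sum_le_card_nsmul _ _ δ fun α _ => ?_).trans (le_of_eq ?_)
    · rw [← mul_sub, abs_mul]
      exact (mul_le_of_le_one_left (abs_nonneg _) (abs_prodBasis_le_one _ _)).trans (h α)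
    · simp
  rw [abs_le] at *
  constructor <;> linarith [h1.1, h1.2, h2.1, h2.2, h3.1, h3.2]

/-- Discretization of the local moments of `G` about the points of `S` to precision `1 / K`. -/
noncomputable def momentClass (S : Finset (EuclideanSpace ℝ (Fin d))) (m K : ℕ)
    (G : Measure (EuclideanSpace ℝ (Fin d))) : S × (Fin d → Fin m) → Fin (2 * K + 1) :=
  fun p => Fin.ofNat _ ⌊K * (localMoment G p.1 p.2 + 1)⌋₊

theorem abs_mixtureDensity_sub_le_of_momentClass_eq {S : Finset (EuclideanSpace ℝ (Fin d))}
    {m K : ℕ} (hK : 0 < K) (G G' : Measure (EuclideanSpace ℝ (Fin d)))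
    [IsProbabilityMeasure G] [IsProbabilityMeasure G']
    (h : momentClass S m K G = momentClass S m K G')
    {s : EuclideanSpace ℝ (Fin d)} (hs : s ∈ S) (x : EuclideanSpace ℝ (Fin d)) :
    |mixtureDensity G x - mixtureDensity G' x|
      ≤ 4 * d * Real.exp (3 * ‖x - s‖ ^ 2 / 2) * (1 / 2) ^ m + m ^ d / K := by
  have hK' : (0 : ℝ) < K := by exact_mod_cast hK
  rw [div_eq_mul_inv ((m : ℝ) ^ d)]
  refine abs_mixtureDensity_sub_le_of_localMoment m G G' s x fun α => ?_
  -- The floor stays below `2K + 1`, so `Fin.ofNat` does not wrap around and equal classes mean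
  -- equal floors.
  have key : ∀ t : ℝ, |t| ≤ 1 → 0 ≤ K * (t + 1) ∧ ⌊K * (t + 1)⌋₊ < 2 * K + 1 := by
    intro t ht
    obtain ⟨h1, h2⟩ := abs_le.1 ht
    have h0 : 0 ≤ K * (t + 1) := by
      have : 0 ≤ t + 1 := by linarith
      positivity
    refine ⟨h0, (Nat.floor_lt h0).2 ?_⟩
    push_cast
    nlinarith
  obtain ⟨a0, a1⟩ := key _ (abs_localMoment_le_one G s α)
  obtain ⟨b0, b1⟩ := key _ (abs_localMoment_le_one G' s α)
  have h' := congrArg Fin.val (congrFun h (⟨s, hs⟩, α))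
  simp only [momentClass, Fin.val_ofNat, Nat.mod_eq_of_lt a1, Nat.mod_eq_of_lt b1] at h'
  have ha := Nat.floor_le a0
  have ha' := Nat.lt_floor_add_one (K * (localMoment G s α + 1))
  have hb := Nat.floor_le b0
  have hb' := Nat.lt_floor_add_one (K * (localMoment G' s α + 1))
  rw [h'] at ha ha'
  have : |K * (localMoment G s α - localMoment G' s α)| ≤ 1 := by
    rw [abs_le]
    constructor <;> linarith
  rw [abs_mul, abs_of_pos hK'] at this
  rw [← one_div, le_div_iff₀' hK']
  exact this

/-! ### Gaussian integrals and tails -/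

theorem lintegral_exp_neg_mul_sq_norm {b : ℝ} (hb : 0 < b) :
    ∫⁻ z : EuclideanSpace ℝ (Fin d), ENNReal.ofReal (Real.exp (-b * ‖z‖ ^ 2))
      = ENNReal.ofReal ((Real.pi / b) ^ ((d : ℝ) / 2)) := by
  have h := GaussianFourier.integral_rexp_neg_mul_sq_norm (V := EuclideanSpace ℝ (Fin d)) hb
  rw [finrank_euclideanSpace_fin] at h
  rw [← h, ofReal_integral_eq_lintegral_ofReal]
  -- Integrability follows from the value: a non-integrable function would have integral 0.
  · by_contra hi
    rw [integral_undef hi] at h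
    have : 0 < (Real.pi / b) ^ ((d : ℝ) / 2) := by positivity
    exact this.ne h
  · exact Filter.Eventually.of_forall fun _ => (Real.exp_pos _).le

theorem two_pi_rpow_mul_rpow (b : ℝ) (hb : 0 < b) :
    (2 * Real.pi) ^ (-(d : ℝ) / 2) * (Real.pi / b) ^ ((d : ℝ) / 2)
      = (1 / (2 * b)) ^ ((d : ℝ) / 2) := by
  rw [neg_div, Real.rpow_neg (by positivity), ← Real.inv_rpow (by positivity),
    ← Real.mul_rpow (by positivity) (by positivity)]
  congr 1
  field_simp

theorem lintegral_gaussianDensity :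
    ∫⁻ z, ENNReal.ofReal (gaussianDensity d z) = 1 := by
  simp_rw [gaussianDensity, ENNReal.ofReal_mul (p := (2 * Real.pi) ^ (-(d : ℝ) / 2))
    (by positivity)]
  rw [lintegral_const_mul _ (by fun_prop)]
  have h := lintegral_exp_neg_mul_sq_norm (d := d) (b := 1 / 2) (by norm_num)
  have e : ∀ z : EuclideanSpace ℝ (Fin d), -‖z‖ ^ 2 / 2 = -(1 / 2) * ‖z‖ ^ 2 := by
    intro z; ring
  simp_rw [e]
  rw [h, ← ENNReal.ofReal_mul (by positivity), two_pi_rpow_mul_rpow _ (by norm_num)]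
  norm_num

/-- Half of the exponent is spent on the tail factor `e^{-r/4}`; the other half keeps the integral
finite. -/
theorem setLIntegral_gaussianDensity_le (r : ℝ) :
    ∫⁻ z in {z | r < ‖z‖ ^ 2}, ENNReal.ofReal (gaussianDensity d z)
      ≤ ENNReal.ofReal (2 ^ ((d : ℝ) / 2) * Real.exp (-r / 4)) := by
  have h := lintegral_exp_neg_mul_sq_norm (d := d) (b := 1 / 4) (by norm_num)
  calc _ ≤ ∫⁻ z in {z | r < ‖z‖ ^ 2}, ENNReal.ofReal ((2 * Real.pi) ^ (-(d : ℝ) / 2)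
          * Real.exp (-r / 4)) * ENNReal.ofReal (Real.exp (-(1 / 4) * ‖z‖ ^ 2)) := by
        refine setLIntegral_mono (by fun_prop) fun z hz => ?_
        rw [← ENNReal.ofReal_mul (by positivity), mul_assoc, ← Real.exp_add]
        unfold gaussianDensity
        gcongr
        simp only [Set.mem_ofPred_eq] at hz
        linarith
    _ ≤ ∫⁻ z, ENNReal.ofReal ((2 * Real.pi) ^ (-(d : ℝ) / 2)
          * Real.exp (-r / 4)) * ENNReal.ofReal (Real.exp (-(1 / 4) * ‖z‖ ^ 2)) :=
        setLIntegral_le_lintegral _ _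
    _ = _ := by
        rw [lintegral_const_mul _ (by fun_prop), h, ← ENNReal.ofReal_mul (by positivity),
          mul_right_comm, two_pi_rpow_mul_rpow _ (by norm_num)]
        norm_num

theorem ofReal_mixtureDensity (G : Measure (EuclideanSpace ℝ (Fin d))) [IsFiniteMeasure G]
    (x : EuclideanSpace ℝ (Fin d)) :
    ENNReal.ofReal (mixtureDensity G x) = ∫⁻ θ, ENNReal.ofReal (gaussianDensity d (x - θ)) ∂G :=
  ofReal_integral_eq_lintegral_ofReal (integrable_gaussianDensity_sub G x)
    (Filter.Eventually.of_forall fun _ => (gaussianDensity_pos _).le)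

theorem measurable_mixtureDensity (G : Measure (EuclideanSpace ℝ (Fin d))) [IsFiniteMeasure G] :
    Measurable (mixtureDensity G) := by
  have : StronglyMeasurable
      (Function.uncurry fun x θ : EuclideanSpace ℝ (Fin d) => gaussianDensity d (x - θ)) :=
    (continuous_gaussianDensity.comp (by fun_prop)).stronglyMeasurable
  exact this.integral_prod_right.measurable

theorem mixtureDensity_pos (G : Measure (EuclideanSpace ℝ (Fin d))) [IsProbabilityMeasure G]
    (x : EuclideanSpace ℝ (Fin d)) : 0 < mixtureDensity G x := by
  refine (integral_pos_iff_support_of_nonneg (fun θ => (gaussianDensity_pos _).le)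
    (integrable_gaussianDensity_sub G x)).2 ?_
  have : Function.support (fun θ => gaussianDensity d (x - θ)) = Set.univ :=
    Set.eq_univ_of_forall fun θ => (gaussianDensity_pos _).ne'
  rw [this, measure_univ]
  exact one_pos

theorem measurable_ofReal_gaussianDensity_sub :
    Measurable (Function.uncurry fun x θ : EuclideanSpace ℝ (Fin d) =>
      ENNReal.ofReal (gaussianDensity d (x - θ))) :=
  ((continuous_gaussianDensity.measurable.comp (by fun_prop)).ennreal_ofReal)

theorem setLIntegral_mixtureDensity (G : Measure (EuclideanSpace ℝ (Fin d))) [IsFiniteMeasure G]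
    (A : Set (EuclideanSpace ℝ (Fin d))) :
    ∫⁻ x in A, ENNReal.ofReal (mixtureDensity G x)
      = ∫⁻ θ, (∫⁻ x in A, ENNReal.ofReal (gaussianDensity d (x - θ))) ∂G := by
  simp_rw [ofReal_mixtureDensity]
  exact lintegral_lintegral_swap measurable_ofReal_gaussianDensity_sub.aemeasurable

theorem lintegral_mixtureDensity (G : Measure (EuclideanSpace ℝ (Fin d)))
    [IsProbabilityMeasure G] : ∫⁻ x, ENNReal.ofReal (mixtureDensity G x) = 1 := by
  rw [← setLIntegral_univ, setLIntegral_mixtureDensity]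
  have (θ : EuclideanSpace ℝ (Fin d)) :
      ∫⁻ x in Set.univ, ENNReal.ofReal (gaussianDensity d (x - θ)) = 1 := by
    rw [setLIntegral_univ,
      lintegral_sub_right_eq_self (fun x => ENNReal.ofReal (gaussianDensity d x)) θ,
      lintegral_gaussianDensity]
  simp only [this, lintegral_const, measure_univ, mul_one]

/-! ### The neighbourhood of the support -/

/-- The points at squared distance at most `r` from `S`. -/
def nearSet (S : Finset (EuclideanSpace ℝ (Fin d))) (r : ℝ) : Set (EuclideanSpace ℝ (Fin d)) :=
  {x | ∃ s ∈ S, ‖x - s‖ ^ 2 ≤ r}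

theorem measurableSet_nearSet (S : Finset (EuclideanSpace ℝ (Fin d))) (r : ℝ) :
    MeasurableSet (nearSet S r) := by
  have : nearSet S r = ⋃ s ∈ S, {x | ‖x - s‖ ^ 2 ≤ r} := by
    ext x; simp [nearSet]
  rw [this]
  exact S.measurableSet_biUnion fun s _ => measurableSet_le (by fun_prop) measurable_const

theorem mixtureLaw_compl_nearSet_le (S : Finset (EuclideanSpace ℝ (Fin d))) (r : ℝ)
    (G : Measure (EuclideanSpace ℝ (Fin d))) [IsProbabilityMeasure G]
    (hG : G ((S : Set (EuclideanSpace ℝ (Fin d)))ᶜ) = 0) :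
    mixtureLaw G (nearSet S r)ᶜ ≤ ENNReal.ofReal (2 ^ ((d : ℝ) / 2) * Real.exp (-r / 4)) := by
  rw [mixtureLaw, withDensity_apply _ (measurableSet_nearSet S r).compl,
    setLIntegral_mixtureDensity]
  have hae : ∀ᵐ θ ∂G, θ ∈ S := by
    rw [ae_iff]
    exact hG
  calc _ ≤ ∫⁻ _, ENNReal.ofReal (2 ^ ((d : ℝ) / 2) * Real.exp (-r / 4)) ∂G := by
        refine lintegral_mono_ae ?_
        filter_upwards [hae] with θ hθ
        refine le_trans ?_ (setLIntegral_gaussianDensity_le r)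
        have hm : MeasurableSet {z : EuclideanSpace ℝ (Fin d) | r < ‖z‖ ^ 2} :=
          measurableSet_lt measurable_const (by fun_prop)
        rw [← lintegral_indicator (measurableSet_nearSet S r).compl, ← lintegral_indicator hm,
          ← lintegral_sub_right_eq_self ({z | r < ‖z‖ ^ 2}.indicator _) θ]
        refine lintegral_mono fun x => ?_
        by_cases hx : x ∈ nearSet S r
        · rw [Set.indicator_of_notMem (by simpa using hx)]
          exact zero_le
        · have : x - θ ∈ {z : EuclideanSpace ℝ (Fin d) | r < ‖z‖ ^ 2} := by
            by_contra hc
            exact hx ⟨θ, hθ, not_lt.1 hc⟩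
          rw [Set.indicator_of_mem hx, Set.indicator_of_mem this]
    _ = _ := by simp

/-- On each ball the normal density about its centre is at least `(2π)^{-d/2} e^{-r/2}`, and it has
total mass 1. -/
theorem volume_nearSet_le (S : Finset (EuclideanSpace ℝ (Fin d))) (r : ℝ) :
    volume (nearSet S r)
      ≤ S.card * ENNReal.ofReal ((2 * Real.pi) ^ ((d : ℝ) / 2) * Real.exp (r / 2)) := by
  have h1 : ∀ s : EuclideanSpace ℝ (Fin d), volume {x | ‖x - s‖ ^ 2 ≤ r}
      ≤ ENNReal.ofReal ((2 * Real.pi) ^ ((d : ℝ) / 2) * Real.exp (r / 2)) := by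
    intro s
    calc volume {x | ‖x - s‖ ^ 2 ≤ r} = ∫⁻ x in {x | ‖x - s‖ ^ 2 ≤ r}, 1 := by simp
      _ ≤ ∫⁻ x in {x | ‖x - s‖ ^ 2 ≤ r},
          ENNReal.ofReal ((2 * Real.pi) ^ ((d : ℝ) / 2) * Real.exp (r / 2))
            * ENNReal.ofReal (gaussianDensity d (x - s)) := by
          refine setLIntegral_mono ((continuous_gaussianDensity.measurable.comp
            (by fun_prop)).ennreal_ofReal.const_mul _) fun x hx => ?_
          rw [← ENNReal.ofReal_mul (by positivity), ← ENNReal.ofReal_one]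
          refine ENNReal.ofReal_le_ofReal ?_
          have e : (2 * Real.pi) ^ ((d : ℝ) / 2) * (2 * Real.pi) ^ (-(d : ℝ) / 2) = 1 := by
            rw [← Real.rpow_add (by positivity), neg_div, add_neg_cancel, Real.rpow_zero]
          calc (1 : ℝ) ≤ Real.exp (r / 2 + -‖x - s‖ ^ 2 / 2) := by
                rw [Real.one_le_exp_iff]
                simp only [Set.mem_ofPred_eq] at hx
                linarith
            _ = ((2 * Real.pi) ^ ((d : ℝ) / 2) * (2 * Real.pi) ^ (-(d : ℝ) / 2))
                * Real.exp (r / 2 + -‖x - s‖ ^ 2 / 2) := by rw [e, one_mul]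
            _ = _ := by rw [Real.exp_add, gaussianDensity]; ring
      _ ≤ ∫⁻ x, ENNReal.ofReal ((2 * Real.pi) ^ ((d : ℝ) / 2) * Real.exp (r / 2))
            * ENNReal.ofReal (gaussianDensity d (x - s)) := setLIntegral_le_lintegral _ _
      _ = _ := by
          rw [lintegral_sub_right_eq_self (fun x =>
            ENNReal.ofReal ((2 * Real.pi) ^ ((d : ℝ) / 2) * Real.exp (r / 2))
            * ENNReal.ofReal (gaussianDensity d x)) s,
            lintegral_const_mul _ continuous_gaussianDensity.measurable.ennreal_ofReal,
            lintegral_gaussianDensity, mul_one]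
  have : nearSet S r = ⋃ s ∈ S, {x | ‖x - s‖ ^ 2 ≤ r} := by
    ext x; simp [nearSet]
  rw [this]
  refine (measure_biUnion_finset_le S _).trans ?_
  refine (Finset.sum_le_card_nsmul S _ _ fun s _ => h1 s).trans ?_
  rw [nsmul_eq_mul]

/-! ### Hellinger affinity with an additive perturbation -/

theorem hellingerSq_le_two (G G' : Measure (EuclideanSpace ℝ (Fin d))) [IsProbabilityMeasure G]
    [IsProbabilityMeasure G'] : hellingerSq (mixtureDensity G) (mixtureDensity G') ≤ 2 := by
  calc hellingerSq (mixtureDensity G) (mixtureDensity G')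
      ≤ ∫⁻ x, (ENNReal.ofReal (mixtureDensity G x) + ENNReal.ofReal (mixtureDensity G' x)) := by
        refine lintegral_mono fun x => ?_
        have h1 := (mixtureDensity_pos G x).le
        have h2 := (mixtureDensity_pos G' x).le
        rw [← ENNReal.ofReal_add h1 h2]
        refine ENNReal.ofReal_le_ofReal ?_
        nlinarith [Real.sq_sqrt h1, Real.sq_sqrt h2, Real.sqrt_nonneg (mixtureDensity G x),
          Real.sqrt_nonneg (mixtureDensity G' x), mul_nonneg (Real.sqrt_nonneg (mixtureDensity G x))
          (Real.sqrt_nonneg (mixtureDensity G' x))]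
    _ = 2 := by
        rw [lintegral_add_left (measurable_mixtureDensity G).ennreal_ofReal,
          lintegral_mixtureDensity, lintegral_mixtureDensity, one_add_one_eq_two]

/-- Uses `√(a+η) ≤ √a + √η` and `2√(ηb) ≤ εb + η/ε`. After integration the first error costs `ε` and
the second `(η/ε)` times the volume of `B`. -/
theorem two_mul_sqrt_add_mul_add_sq_sub_le {a b η ε : ℝ} (ha : 0 ≤ a) (hb : 0 ≤ b) (hη : 0 ≤ η)
    (hε : 0 < ε) : 2 * √((a + η) * b) + (√a - √b) ^ 2 ≤ a + b + ε * b + η / ε := by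
  have h1 : √((a + η) * b) ≤ √a * √b + √η * √b := by
    rw [Real.sqrt_mul (by positivity), ← add_mul]
    gcongr
    rw [Real.sqrt_le_left (by positivity)]
    nlinarith [Real.sq_sqrt ha, Real.sq_sqrt hη, mul_nonneg (Real.sqrt_nonneg a)
      (Real.sqrt_nonneg η)]
  have h2 : 2 * (√η * √b) ≤ ε * b + η / ε := by
    have e : ε * b + η / ε - 2 * (√η * √b) = (ε * √b - √η) ^ 2 / ε := by
      field_simp
      rw [sub_sq, mul_pow, Real.sq_sqrt hb, Real.sq_sqrt hη]
      ring
    have : 0 ≤ (ε * √b - √η) ^ 2 / ε := by positivity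
    linarith
  nlinarith [Real.sq_sqrt ha, Real.sq_sqrt hb]

theorem two_mul_setLIntegral_sqrt_add_hellingerSq_le
    (G G₀ : Measure (EuclideanSpace ℝ (Fin d))) [IsProbabilityMeasure G]
    [IsProbabilityMeasure G₀] {B : Set (EuclideanSpace ℝ (Fin d))} (hB : MeasurableSet B)
    {η ε : ℝ} (hη : 0 ≤ η) (hε : 0 < ε) :
    2 * (∫⁻ x in B, ENNReal.ofReal (√((mixtureDensity G x + η) * mixtureDensity G₀ x)))
        + hellingerSq (mixtureDensity G) (mixtureDensity G₀)
      ≤ 2 + ENNReal.ofReal ε + ENNReal.ofReal (η / ε) * volume B := by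
  have mG := measurable_mixtureDensity G
  have m0 := measurable_mixtureDensity G₀
  rw [hellingerSq, ← lintegral_const_mul _ (by fun_prop), ← lintegral_indicator hB,
    ← lintegral_add_right _ (by fun_prop)]
  calc _ ≤ ∫⁻ x, (ENNReal.ofReal (mixtureDensity G x) + ENNReal.ofReal (mixtureDensity G₀ x)
        + ENNReal.ofReal ε * ENNReal.ofReal (mixtureDensity G₀ x)
        + B.indicator (fun _ => ENNReal.ofReal (η / ε)) x) := by
        refine lintegral_mono fun x => ?_
        have h1 := (mixtureDensity_pos G x).le
        have h2 := (mixtureDensity_pos G₀ x).le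
        by_cases hx : x ∈ B
        · simp only [Set.indicator_of_mem hx]
          rw [← ENNReal.ofReal_ofNat, ← ENNReal.ofReal_mul (by norm_num),
            ← ENNReal.ofReal_mul hε.le, ← ENNReal.ofReal_add (by positivity) (by positivity),
            ← ENNReal.ofReal_add h1 h2, ← ENNReal.ofReal_add (by positivity) (by positivity),
            ← ENNReal.ofReal_add (by positivity) (by positivity)]
          exact ENNReal.ofReal_le_ofReal (two_mul_sqrt_add_mul_add_sq_sub_le h1 h2 hη hε)
        · simp only [Set.indicator_of_notMem hx, zero_add, add_zero]
          rw [← ENNReal.ofReal_mul hε.le, ← ENNReal.ofReal_add h1 h2,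
            ← ENNReal.ofReal_add (by positivity) (by positivity)]
          refine ENNReal.ofReal_le_ofReal ?_
          -- Off `B` there is no root term, so the case `η = 0` suffices.
          have := two_mul_sqrt_add_mul_add_sq_sub_le h1 h2 le_rfl hε
          simp only [zero_div, add_zero] at this
          linarith [Real.sqrt_nonneg (mixtureDensity G x * mixtureDensity G₀ x)]
    _ = _ := by
        rw [lintegral_add_left (by fun_prop), lintegral_add_left (by fun_prop),
          lintegral_add_left (by fun_prop), lintegral_const_mul _ (by fun_prop),
          lintegral_mixtureDensity, lintegral_mixtureDensity, lintegral_indicator hB,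
          setLIntegral_const, mul_one, one_add_one_eq_two]

/-! ### Averaging over non-identical laws -/

instance isProbabilityMeasure_averageMeasure {n : ℕ} [NeZero n]
    (G : Fin n → Measure (EuclideanSpace ℝ (Fin d))) [∀ i, IsProbabilityMeasure (G i)] :
    IsProbabilityMeasure (averageMeasure G) := by
  constructor
  have : (n : ENNReal) ≠ 0 := by exact_mod_cast NeZero.ne n
  simp [averageMeasure, ENNReal.inv_mul_cancel this]

theorem nat_mul_ofReal_mixtureDensity_averageMeasure {n : ℕ} [NeZero n]
    (G : Fin n → Measure (EuclideanSpace ℝ (Fin d))) [∀ i, IsProbabilityMeasure (G i)]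
    (x : EuclideanSpace ℝ (Fin d)) :
    (n : ENNReal) * ENNReal.ofReal (mixtureDensity (averageMeasure G) x)
      = ∑ i, ENNReal.ofReal (mixtureDensity (G i) x) := by
  have h : (n : ENNReal) ≠ 0 := by exact_mod_cast NeZero.ne n
  simp_rw [ofReal_mixtureDensity]
  rw [averageMeasure, lintegral_smul_measure, lintegral_finsetSum_measure, smul_eq_mul, ← mul_assoc,
    ENNReal.mul_inv_cancel h (by simp), one_mul]

theorem measure_eq_zero_of_averageMeasure {n : ℕ}
    (G : Fin n → Measure (EuclideanSpace ℝ (Fin d))) {A : Set (EuclideanSpace ℝ (Fin d))}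
    (h : averageMeasure G A = 0) (i : Fin n) : G i A = 0 := by
  simp only [averageMeasure, Measure.smul_apply, smul_eq_mul, mul_eq_zero, ENNReal.inv_eq_zero,
    ENNReal.natCast_ne_top, false_or, Measure.finsetSum_apply, Finset.sum_eq_zero_iff] at h
  exact h i (Finset.mem_univ i)

/-- From `a ≤ e^{a-1}`. It replaces the product of expectations by their sum, which depends on the
`G_i` only through their average. -/
theorem prod_le_ofReal_exp_of_sum_le {n : ℕ} (a : Fin n → ENNReal) {t : ℝ}
    (hfin : ∀ i, a i ≠ ⊤) (h : ∑ i, (a i).toReal ≤ n + t) :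
    ∏ i, a i ≤ ENNReal.ofReal (Real.exp t) := by
  have h1 : ∏ i, a i = ENNReal.ofReal (∏ i, (a i).toReal) := by
    rw [ENNReal.ofReal_prod_of_nonneg fun i _ => ENNReal.toReal_nonneg]
    exact Finset.prod_congr rfl fun i _ => (ENNReal.ofReal_toReal (hfin i)).symm
  rw [h1]
  refine ENNReal.ofReal_le_ofReal ?_
  calc ∏ i, (a i).toReal ≤ ∏ i, Real.exp ((a i).toReal - 1) :=
        Finset.prod_le_prod (fun _ _ => ENNReal.toReal_nonneg) fun i _ => by
          linarith [Real.add_one_le_exp ((a i).toReal - 1)]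
    _ = Real.exp (∑ i, (a i).toReal - n) := by
        rw [← Real.exp_sum, Finset.sum_sub_distrib]
        simp
    _ ≤ Real.exp t := by
        gcongr
        linarith

/-- The root likelihood ratio of `f_G + η` against `f_{G₀}`, restricted to `B`. -/
noncomputable def rootLikelihoodRatio (G G₀ : Measure (EuclideanSpace ℝ (Fin d))) (η : ℝ)
    (B : Set (EuclideanSpace ℝ (Fin d))) : EuclideanSpace ℝ (Fin d) → ENNReal :=
  B.indicator fun x => ENNReal.ofReal (√((mixtureDensity G x + η) / mixtureDensity G₀ x))

theorem measurable_rootLikelihoodRatio (G G₀ : Measure (EuclideanSpace ℝ (Fin d)))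
    [IsFiniteMeasure G] [IsFiniteMeasure G₀] (η : ℝ) {B : Set (EuclideanSpace ℝ (Fin d))}
    (hB : MeasurableSet B) : Measurable (rootLikelihoodRatio G G₀ η B) := by
  have mG := measurable_mixtureDensity G
  have m0 := measurable_mixtureDensity G₀
  exact Measurable.indicator (by fun_prop) hB

theorem lintegral_rootLikelihoodRatio_mul (G G₀ : Measure (EuclideanSpace ℝ (Fin d)))
    [IsProbabilityMeasure G₀] (η : ℝ) {B : Set (EuclideanSpace ℝ (Fin d))}
    (hB : MeasurableSet B) :
    ∫⁻ x, rootLikelihoodRatio G G₀ η B x * ENNReal.ofReal (mixtureDensity G₀ x)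
      = ∫⁻ x in B, ENNReal.ofReal (√((mixtureDensity G x + η) * mixtureDensity G₀ x)) := by
  rw [← lintegral_indicator hB]
  refine lintegral_congr fun x => ?_
  by_cases hx : x ∈ B
  · have h0 := mixtureDensity_pos G₀ x
    rw [rootLikelihoodRatio, Set.indicator_of_mem hx, Set.indicator_of_mem hx,
      ← ENNReal.ofReal_mul (Real.sqrt_nonneg _)]
    congr 1
    have e : (mixtureDensity G x + η) * mixtureDensity G₀ x
        = (mixtureDensity G x + η) / mixtureDensity G₀ x * mixtureDensity G₀ x ^ 2 := by
      field_simp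
    rw [e, Real.sqrt_mul' _ (by positivity), Real.sqrt_sq h0.le]
  · rw [rootLikelihoodRatio, Set.indicator_of_notMem hx, Set.indicator_of_notMem hx, zero_mul]

theorem sum_lintegral_rootLikelihoodRatio {n : ℕ} [NeZero n]
    (G : Fin n → Measure (EuclideanSpace ℝ (Fin d))) [∀ i, IsProbabilityMeasure (G i)]
    (H : Measure (EuclideanSpace ℝ (Fin d))) [IsFiniteMeasure H] (η : ℝ)
    {B : Set (EuclideanSpace ℝ (Fin d))} (hB : MeasurableSet B) :
    ∑ i, ∫⁻ x, rootLikelihoodRatio H (averageMeasure G) η B x ∂(mixtureLaw (G i))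
      = n * ∫⁻ x in B, ENNReal.ofReal
          (√((mixtureDensity H x + η) * mixtureDensity (averageMeasure G) x)) := by
  have mw := measurable_rootLikelihoodRatio H (averageMeasure G) η hB
  have mf := fun i => (measurable_mixtureDensity (G i)).ennreal_ofReal
  have m0 := measurable_mixtureDensity (averageMeasure G)
  rw [← lintegral_rootLikelihoodRatio_mul H _ η hB, ← lintegral_const_mul _ (by fun_prop)]
  simp_rw [mul_left_comm (n : ENNReal), nat_mul_ofReal_mixtureDensity_averageMeasure,
    Finset.mul_sum]
  rw [lintegral_finsetSum _ (by fun_prop)]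
  refine Finset.sum_congr rfl fun i _ => ?_
  rw [mixtureLaw, lintegral_withDensity_eq_lintegral_mul _ (mf i) mw]
  exact lintegral_congr fun x => mul_comm _ _

/-! ### Exponential bound and union over classes -/

section Risk

variable {n : ℕ} {Ω : Type*} [MeasurableSpace Ω] {P : Measure Ω}
  {X : Fin n → Ω → EuclideanSpace ℝ (Fin d)}

theorem lintegral_prod_rootLikelihoodRatio_le [NeZero n]
    (G : Fin n → Measure (EuclideanSpace ℝ (Fin d))) [∀ i, IsProbabilityMeasure (G i)]
    (hX : ∀ i, Measurable (X i)) (hind : iIndepFun X P)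
    (hlaw : ∀ i, P.map (X i) = mixtureLaw (G i))
    (H : Measure (EuclideanSpace ℝ (Fin d))) [IsProbabilityMeasure H]
    {B : Set (EuclideanSpace ℝ (Fin d))} (hB : MeasurableSet B) {η τ : ℝ} (hη : 0 ≤ η)
    (hτ : 0 ≤ τ) (hvol : ENNReal.ofReal (η * n) * volume B ≤ ENNReal.ofReal (1 / n))
    (hH : ENNReal.ofReal τ ≤ hellingerSq (mixtureDensity H) (mixtureDensity (averageMeasure G))) :
    ∫⁻ ω, ∏ i, rootLikelihoodRatio H (averageMeasure G) η B (X i ω) ∂P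
      ≤ ENNReal.ofReal (Real.exp (1 - n * τ / 2)) := by
  have hn : (0 : ℝ) < n := by exact_mod_cast NeZero.pos n
  have mw := measurable_rootLikelihoodRatio H (averageMeasure G) η hB
  rw [lintegral_prod_eq_prod_lintegral_of_indepFun _
    (fun i ω => rootLikelihoodRatio H (averageMeasure G) η B (X i ω))
    (hind.comp (fun _ => rootLikelihoodRatio H (averageMeasure G) η B) fun _ => mw)
    fun i => mw.comp (hX i)]
  simp_rw [← lintegral_map mw (hX _), hlaw]
  have hsum := sum_lintegral_rootLikelihoodRatio G H η hB
  -- With `ε = 1/n`, both errors are at most `1/n`; over `n` observations they contribute the `1` in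
  -- the exponent.
  have hkey := two_mul_setLIntegral_sqrt_add_hellingerSq_le H (averageMeasure G) hB hη
    (one_div_pos.2 hn)
  rw [div_div_eq_mul_div, div_one] at hkey
  set I := ∫⁻ x in B, ENNReal.ofReal
    (√((mixtureDensity H x + η) * mixtureDensity (averageMeasure G) x))
  have hI : 2 * I + ENNReal.ofReal τ ≤ ENNReal.ofReal (2 + 1 / n + 1 / n) := by
    rw [ENNReal.ofReal_add (by positivity) (by positivity),
      ENNReal.ofReal_add (by positivity) (by positivity), ENNReal.ofReal_ofNat]
    exact (add_le_add_right hH _).trans (hkey.trans (add_le_add_right hvol _))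
  have hIfin : I ≠ ⊤ := by
    intro hI'
    simp [hI'] at hI
  have hIreal : 2 * I.toReal + τ ≤ 2 + 1 / n + 1 / n := by
    have := ENNReal.toReal_mono ENNReal.ofReal_ne_top hI
    rwa [ENNReal.toReal_ofReal (by positivity), ENNReal.toReal_add (by finiteness) (by finiteness),
      ENNReal.toReal_mul, ENNReal.toReal_ofReal hτ, ENNReal.toReal_ofNat] at this
  have hfin : ∀ i, ∫⁻ x, rootLikelihoodRatio H (averageMeasure G) η B x ∂(mixtureLaw (G i)) ≠ ⊤ :=
    fun i => by
      refine ne_top_of_le_ne_top (b := n * I) (by finiteness) ?_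
      rw [← hsum]
      exact Finset.single_le_sum (f := fun i =>
        ∫⁻ x, rootLikelihoodRatio H (averageMeasure G) η B x ∂(mixtureLaw (G i)))
        (fun _ _ => zero_le) (Finset.mem_univ i)
  refine prod_le_ofReal_exp_of_sum_le _ hfin ?_
  rw [← ENNReal.toReal_sum fun i _ => hfin i, hsum, ENNReal.toReal_mul, ENNReal.toReal_natCast]
  have h2 : (n : ℝ) * (2 * I.toReal + τ) ≤ n * (2 + 1 / n + 1 / n) := by gcongr
  have h3 : (n : ℝ) * (2 + 1 / n + 1 / n) = 2 * n + 2 := by field_simp; ring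
  linarith

theorem prod_le_prod_of_isNPMLE [NeZero n] {x : Fin n → EuclideanSpace ℝ (Fin d)}
    {H G₀ : Measure (EuclideanSpace ℝ (Fin d))} [IsProbabilityMeasure H]
    [IsProbabilityMeasure G₀] (h : IsNPMLE x (mixtureDensity H)) :
    ∏ i, mixtureDensity G₀ (x i) ≤ ∏ i, mixtureDensity H (x i) := by
  have hn : (0 : ℝ) < n := by exact_mod_cast NeZero.pos n
  have hmax := h.2 (show mixtureDensity G₀ ∈ mixtureClass d from ⟨G₀, ‹_›, rfl⟩)
  simp only [Set.mem_ofPred_eq] at hmax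
  have h1 := le_of_mul_le_mul_left hmax (by positivity)
  rw [← Real.log_prod fun i _ => (mixtureDensity_pos G₀ _).ne',
    ← Real.log_prod fun i _ => (mixtureDensity_pos H _).ne'] at h1
  exact (Real.log_le_log_iff (Finset.prod_pos fun i _ => mixtureDensity_pos G₀ _)
    (Finset.prod_pos fun i _ => mixtureDensity_pos H _)).1 h1

theorem one_le_prod_rootLikelihoodRatio {x : Fin n → EuclideanSpace ℝ (Fin d)}
    {H H' G₀ : Measure (EuclideanSpace ℝ (Fin d))} [IsProbabilityMeasure H]
    [IsProbabilityMeasure G₀] {B : Set (EuclideanSpace ℝ (Fin d))} {η : ℝ}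
    (h : ∏ i, mixtureDensity G₀ (x i) ≤ ∏ i, mixtureDensity H (x i)) (hx : ∀ i, x i ∈ B)
    (hη : ∀ i, mixtureDensity H (x i) ≤ mixtureDensity H' (x i) + η) :
    1 ≤ ∏ i, rootLikelihoodRatio H' G₀ η B (x i) := by
  have hpos := fun y => mixtureDensity_pos G₀ y
  have hposH := fun y => mixtureDensity_pos H y
  simp_rw [rootLikelihoodRatio, Set.indicator_of_mem (hx _)]
  rw [← ENNReal.ofReal_prod_of_nonneg fun i _ => Real.sqrt_nonneg _, ← ENNReal.ofReal_one]
  refine ENNReal.ofReal_le_ofReal ?_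
  calc (1 : ℝ) ≤ √(∏ i, mixtureDensity H (x i) / mixtureDensity G₀ (x i)) := by
        rw [Real.one_le_sqrt, Finset.prod_div_distrib,
          one_le_div (Finset.prod_pos fun i _ => hpos _)]
        exact h
    _ = ∏ i, √(mixtureDensity H (x i) / mixtureDensity G₀ (x i)) :=
        Real.sqrt_prod _ fun i _ => (div_pos (hposH _) (hpos _)).le
    _ ≤ _ := Finset.prod_le_prod (fun _ _ => Real.sqrt_nonneg _) fun i _ =>
        Real.sqrt_le_sqrt (div_le_div_of_nonneg_right (hη i) (hpos _).le)

/-- The loss is dominated pointwise by a measurable function of the data, so `fhat` need not be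
measurable. -/
theorem lintegral_hellingerSq_isNPMLE_le [NeZero n]
    (G : Fin n → Measure (EuclideanSpace ℝ (Fin d))) [∀ i, IsProbabilityMeasure (G i)]
    (hX : ∀ i, Measurable (X i)) (hind : iIndepFun X P)
    (hlaw : ∀ i, P.map (X i) = mixtureLaw (G i))
    {fhat : Ω → EuclideanSpace ℝ (Fin d) → ℝ} (hf : ∀ ω, IsNPMLE (fun i => X i ω) (fhat ω))
    (S : Finset (EuclideanSpace ℝ (Fin d))) {r η τ : ℝ} {m K : ℕ} (hK : 0 < K) (hη : 0 ≤ η)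
    (hτ : 0 ≤ τ)
    (hvol : ENNReal.ofReal (η * n) * volume (nearSet S r) ≤ ENNReal.ofReal (1 / n))
    (hent : 4 * d * Real.exp (3 * r / 2) * (1 / 2) ^ m + m ^ d / K ≤ η) :
    ∫⁻ ω, hellingerSq (fhat ω) (mixtureDensity (averageMeasure G)) ∂P
      ≤ ENNReal.ofReal τ + 2 * ((2 * K + 1 : ℕ) ^ (S.card * m ^ d)
          * ENNReal.ofReal (Real.exp (1 - n * τ / 2))
          + ∑ i, mixtureLaw (G i) (nearSet S r)ᶜ) := by
  classical
  have hB := measurableSet_nearSet S r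
  have : IsProbabilityMeasure P := hind.isProbabilityMeasure
  set B := nearSet S r
  set G₀ := averageMeasure G
  let p (j : S × (Fin d → Fin m) → Fin (2 * K + 1)) : Prop :=
    ∃ H : Measure (EuclideanSpace ℝ (Fin d)), IsProbabilityMeasure H ∧ momentClass S m K H = j ∧
      ENNReal.ofReal τ ≤ hellingerSq (mixtureDensity H) (mixtureDensity G₀)
  -- One representative at distance at least `τ` is fixed per class, independently of `ω`; classes
  -- without one contribute 0.
  let W (j : S × (Fin d → Fin m) → Fin (2 * K + 1)) (ω : Ω) : ENNReal :=
    if h : p j then ∏ i, rootLikelihoodRatio h.choose G₀ η B (X i ω) else 0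
  have hWm : ∀ j, Measurable (W j) := by
    intro j
    by_cases h : p j
    · have := h.choose_spec.1
      simp only [W, h, dite_true]
      exact Finset.measurable_prod _ fun i _ =>
        (measurable_rootLikelihoodRatio _ _ η hB).comp (hX i)
    · simp only [W, h, dite_false]
      exact measurable_const
  have hWint : ∀ j, ∫⁻ ω, W j ω ∂P ≤ ENNReal.ofReal (Real.exp (1 - n * τ / 2)) := by
    intro j
    by_cases h : p j
    · have := h.choose_spec.1
      simp only [W, h, dite_true]
      exact lintegral_prod_rootLikelihoodRatio_le G hX hind hlaw _ hB hη hτ hvol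
        h.choose_spec.2.2
    · simp [W, h]
  have hpt : ∀ ω, hellingerSq (fhat ω) (mixtureDensity G₀)
      ≤ ENNReal.ofReal τ + 2 * (∑ j, W j ω + ∑ i, (X i ⁻¹' Bᶜ).indicator 1 ω) := by
    intro ω
    obtain ⟨H, hH, hfH⟩ := (hf ω).1
    have hω := hf ω
    rw [hfH] at hω ⊢
    rcases le_total (hellingerSq (mixtureDensity H) (mixtureDensity G₀)) (ENNReal.ofReal τ)
      with hle | hge
    · exact hle.trans le_self_add
    -- The loss is at most 2, so it is enough that one class product or one exit indicator reaches
    -- 1.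
    · suffices 1 ≤ ∑ j, W j ω + ∑ i, (X i ⁻¹' Bᶜ).indicator 1 ω from
        (hellingerSq_le_two H G₀).trans (le_trans (by simpa using mul_le_mul_right this 2)
          le_add_self)
      by_cases hx : ∀ i, X i ω ∈ B
      · have hpj : p (momentClass S m K H) := ⟨H, hH, rfl, hge⟩
        have hW1 : 1 ≤ W (momentClass S m K H) ω := by
          have hprob := hpj.choose_spec.1
          have hcl := hpj.choose_spec.2.1
          simp only [W, hpj, dite_true]
          refine one_le_prod_rootLikelihoodRatio (prod_le_prod_of_isNPMLE hω) hx fun i => ?_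
          obtain ⟨s, hs, hsx⟩ := hx i
          have h1 := abs_mixtureDensity_sub_le_of_momentClass_eq hK H hpj.choose hcl.symm hs (X i ω)
          have h2 : 4 * d * Real.exp (3 * ‖X i ω - s‖ ^ 2 / 2) * (1 / 2) ^ m + m ^ d / K
              ≤ 4 * d * Real.exp (3 * r / 2) * (1 / 2) ^ m + m ^ d / K := by gcongr
          linarith [le_abs_self (mixtureDensity H (X i ω) - mixtureDensity hpj.choose (X i ω))]
        exact hW1.trans ((Finset.single_le_sum (f := fun j => W j ω) (fun _ _ => zero_le)
          (Finset.mem_univ _)).trans le_self_add)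
      · push Not at hx
        obtain ⟨i, hi⟩ := hx
        have h1 : (1 : ENNReal) ≤ (X i ⁻¹' Bᶜ).indicator 1 ω := by
          rw [Set.indicator_of_mem (by exact hi)]
          rfl
        exact h1.trans ((Finset.single_le_sum
          (f := fun i => (X i ⁻¹' Bᶜ).indicator (1 : Ω → ENNReal) ω) (fun _ _ => zero_le)
          (Finset.mem_univ i)).trans le_add_self)
  have hind_m : ∀ i, Measurable ((X i ⁻¹' Bᶜ).indicator (1 : Ω → ENNReal)) := fun i =>
    measurable_one.indicator (hX i hB.compl)
  refine (lintegral_mono hpt).trans ?_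
  rw [lintegral_add_left measurable_const, lintegral_const, measure_univ, mul_one,
    lintegral_const_mul _ (by fun_prop),
    lintegral_add_left (Finset.measurable_fun_sum _ fun j _ => hWm j),
    lintegral_finsetSum _ fun j _ => hWm j, lintegral_finsetSum _ fun i _ => hind_m i]
  gcongr with i _
  · refine (Finset.sum_le_card_nsmul _ _ _ fun j _ => hWint j).trans (le_of_eq ?_)
    simp
  · rw [lintegral_indicator_one (hX i hB.compl), ← Measure.map_apply (hX i) hB.compl, hlaw]

end Risk

/-! ### Choice of parameters -/

theorem natClog_two_le {n : ℕ} (hn : 2 ≤ n) : (Nat.clog 2 n : ℝ) ≤ 3 * Real.log n := by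
  have hlt : (2 : ℝ) ^ (Nat.clog 2 n - 1) < n := by
    exact_mod_cast Nat.pow_pred_clog_lt_self (by norm_num) (by omega)
  have h1 : 1 ≤ Nat.clog 2 n := Nat.clog_pos (by norm_num) hn
  have h := Real.log_lt_log (by positivity) hlt
  rw [Real.log_pow, Nat.cast_sub h1, Nat.cast_one] at h
  have hl2 := Real.log_two_gt_d9
  have hl : Real.log 2 ≤ Real.log n := Real.log_le_log (by norm_num) (by exact_mod_cast hn)
  have h1' : (1 : ℝ) ≤ Nat.clog 2 n := by exact_mod_cast h1
  nlinarith

/-- Parameters of the discretization for which the approximation error on `nearSet S r`,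
`r = 4 (d + 2) log n`, is at most `n ^ (-(5 d + 7))`. -/
theorem approximation_error_le (d : ℕ) {n : ℕ} (hn : 2 ≤ n) :
    4 * d * Real.exp (3 * (4 * (d + 2) * Real.log n) / 2)
        * (1 / 2) ^ ((12 * d + 22) * Nat.clog 2 n)
      + (((12 * d + 22) * Nat.clog 2 n : ℕ) : ℝ) ^ d / (n ^ ((12 * d + 23) * d + 5 * d + 8) : ℕ)
      ≤ 1 / (n : ℝ) ^ (5 * d + 7) := by
  have hN : (2 : ℝ) ≤ n := by exact_mod_cast hn
  have hN0 : (0 : ℝ) < n := by linarith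
  have hpow : ∀ j : ℕ, (2 : ℝ) ^ j ≤ (n : ℝ) ^ j := fun j => by gcongr
  have hexp : Real.exp (3 * (4 * (d + 2) * Real.log n) / 2) = (n : ℝ) ^ (6 * d + 12) := by
    rw [← Real.exp_log (pow_pos hN0 _), Real.log_pow]
    congr 1; push_cast; ring
  have hclog : (n : ℝ) ≤ 2 ^ Nat.clog 2 n := by
    exact_mod_cast Nat.le_pow_clog (by norm_num) n
  have hhalf : ((1 : ℝ) / 2) ^ ((12 * d + 22) * Nat.clog 2 n) ≤ 1 / (n : ℝ) ^ (12 * d + 22) := by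
    rw [one_div_pow, mul_comm, pow_mul]
    gcongr
  have h8 : (8 : ℝ) * d ≤ n ^ (d + 3) := by
    have : (d : ℝ) ≤ 2 ^ d := by exact_mod_cast Nat.lt_two_pow_self.le
    calc (8 : ℝ) * d ≤ 2 ^ (d + 3) := by rw [pow_add]; linarith
      _ ≤ _ := hpow _
  have hm : (((12 * d + 22) * Nat.clog 2 n : ℕ) : ℝ) ≤ (n : ℝ) ^ (12 * d + 23) := by
    have h1 : ((12 * d + 22 : ℕ) : ℝ) ≤ (n : ℝ) ^ (12 * d + 22) :=
      le_trans (by exact_mod_cast Nat.lt_two_pow_self.le) (hpow _)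
    have h2 : (Nat.clog 2 n : ℝ) ≤ n := by
      exact_mod_cast Nat.clog_le_of_le_pow Nat.lt_two_pow_self.le
    rw [Nat.cast_mul, pow_succ]
    gcongr
  -- Each error gets half the budget. Here `12d+22 = (d+3) + (6d+12) + (5d+7)`: the factor `4d`, the
  -- exponential, the target.
  have e1 : 4 * d * Real.exp (3 * (4 * (d + 2) * Real.log n) / 2)
      * (1 / 2) ^ ((12 * d + 22) * Nat.clog 2 n) ≤ 1 / 2 * (1 / (n : ℝ) ^ (5 * d + 7)) := by
    rw [hexp]
    have h4 : 4 * (d : ℝ) ≤ 1 / 2 * (n : ℝ) ^ (d + 3) := by linarith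
    calc _ ≤ 1 / 2 * (n : ℝ) ^ (d + 3) * (n : ℝ) ^ (6 * d + 12)
          * (1 / (n : ℝ) ^ (12 * d + 22)) := by
          gcongr ?_ * _ * ?_
      _ = _ := by
          have : (n : ℝ) ^ (12 * d + 22)
              = (n : ℝ) ^ (d + 3) * (n : ℝ) ^ (6 * d + 12) * (n : ℝ) ^ (5 * d + 7) := by
            rw [← pow_add, ← pow_add]; congr 1; ring
          rw [this]
          field_simp
  -- The exponent of `K` pays for `m^d`, for the target, and for one more `n ≥ 2` that yields the
  -- factor `1/2`.
  have e2 : (((12 * d + 22) * Nat.clog 2 n : ℕ) : ℝ) ^ d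
      / (n ^ ((12 * d + 23) * d + 5 * d + 8) : ℕ) ≤ 1 / 2 * (1 / (n : ℝ) ^ (5 * d + 7)) := by
    have h1 : (((12 * d + 22) * Nat.clog 2 n : ℕ) : ℝ) ^ d ≤ (n : ℝ) ^ ((12 * d + 23) * d) := by
      rw [pow_mul]; gcongr
    have h2 : (n : ℝ) ^ ((12 * d + 23) * d + 5 * d + 8)
        = (n : ℝ) ^ ((12 * d + 23) * d) * (n : ℝ) ^ (5 * d + 7) * n := by
      rw [← pow_add, ← pow_succ]; congr 1
    rw [Nat.cast_pow, h2]
    calc _ ≤ (n : ℝ) ^ ((12 * d + 23) * d)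
          / ((n : ℝ) ^ ((12 * d + 23) * d) * (n : ℝ) ^ (5 * d + 7) * 2) := by gcongr
      _ = _ := by field_simp
  linarith

/-- This fixes the exponent in `η = n^{-(5d+7)}`: the volume is at most `n · n^{3d} · n^{2d+4}`. -/
theorem volume_nearSet_log_le {d n : ℕ} (hn : 2 ≤ n) (S : Finset (EuclideanSpace ℝ (Fin d)))
    (hS : S.card ≤ n) :
    ENNReal.ofReal (1 / (n : ℝ) ^ (5 * d + 7) * n) * volume (nearSet S (4 * (d + 2) * Real.log n))
      ≤ ENNReal.ofReal (1 / n) := by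
  have hN : (2 : ℝ) ≤ n := by exact_mod_cast hn
  have hN0 : (0 : ℝ) < n := by linarith
  have hexp : Real.exp (4 * (d + 2) * Real.log n / 2) = (n : ℝ) ^ (2 * d + 4) := by
    rw [← Real.exp_log (pow_pos hN0 _), Real.log_pow]
    congr 1; push_cast; ring
  have hpi : (2 * Real.pi) ^ ((d : ℝ) / 2) ≤ (n : ℝ) ^ (3 * d) := by
    calc (2 * Real.pi) ^ ((d : ℝ) / 2) ≤ (2 * Real.pi) ^ (d : ℝ) := by
          gcongr
          · linarith [Real.pi_gt_three]
          · have : (0 : ℝ) ≤ d := by positivity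
            linarith
      _ = (2 * Real.pi) ^ d := Real.rpow_natCast _ _
      _ ≤ (2 ^ 3) ^ d := by
          gcongr
          linarith [Real.pi_lt_four]
      _ = 2 ^ (3 * d) := by rw [pow_mul]
      _ ≤ _ := by gcongr
  have hS' : (S.card : ℝ) ≤ n := by exact_mod_cast hS
  calc _ ≤ ENNReal.ofReal (1 / (n : ℝ) ^ (5 * d + 7) * n) * (S.card * ENNReal.ofReal
        ((2 * Real.pi) ^ ((d : ℝ) / 2) * Real.exp (4 * (d + 2) * Real.log n / 2))) := by
        gcongr
        exact volume_nearSet_le S _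
    _ = ENNReal.ofReal (1 / (n : ℝ) ^ (5 * d + 7) * n * (S.card *
        ((2 * Real.pi) ^ ((d : ℝ) / 2) * Real.exp (4 * (d + 2) * Real.log n / 2)))) := by
        rw [ENNReal.ofReal_mul (p := 1 / (n : ℝ) ^ (5 * d + 7) * n) (by positivity),
          ENNReal.ofReal_mul (p := (S.card : ℝ)) (by positivity), ENNReal.ofReal_natCast]
    _ ≤ ENNReal.ofReal (1 / (n : ℝ) ^ (5 * d + 7) * n * (n *
        ((n : ℝ) ^ (3 * d) * (n : ℝ) ^ (2 * d + 4)))) := by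
        rw [hexp]
        gcongr
    _ = _ := by
        congr 1
        have : (n : ℝ) ^ (5 * d + 7) = (n : ℝ) ^ (3 * d) * (n : ℝ) ^ (2 * d + 4) * n * n * n := by
          rw [← pow_add, ← pow_succ, ← pow_succ, ← pow_succ]; congr 1; ring
        rw [this]
        field_simp

theorem mixtureLaw_compl_nearSet_log_le {d n : ℕ} (hn : 2 ≤ n)
    (S : Finset (EuclideanSpace ℝ (Fin d))) (G : Measure (EuclideanSpace ℝ (Fin d)))
    [IsProbabilityMeasure G] (hG : G ((S : Set (EuclideanSpace ℝ (Fin d)))ᶜ) = 0) :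
    mixtureLaw G (nearSet S (4 * (d + 2) * Real.log n))ᶜ ≤ ENNReal.ofReal (1 / (n : ℝ) ^ 2) := by
  have hN : (2 : ℝ) ≤ n := by exact_mod_cast hn
  have hN0 : (0 : ℝ) < n := by linarith
  refine (mixtureLaw_compl_nearSet_le S _ G hG).trans (ENNReal.ofReal_le_ofReal ?_)
  have hexp : Real.exp (-(4 * (d + 2) * Real.log n) / 4) = 1 / (n : ℝ) ^ (d + 2) := by
    rw [one_div, ← Real.exp_log (pow_pos hN0 _), ← Real.exp_neg, Real.log_pow]
    congr 1; push_cast; ring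
  have h2 : (2 : ℝ) ^ ((d : ℝ) / 2) ≤ (n : ℝ) ^ d := by
    calc (2 : ℝ) ^ ((d : ℝ) / 2) ≤ 2 ^ (d : ℝ) := by
          gcongr
          · norm_num
          · have : (0 : ℝ) ≤ d := by positivity
            linarith
      _ = 2 ^ d := Real.rpow_natCast _ _
      _ ≤ _ := by gcongr
  rw [hexp, pow_add]
  calc _ ≤ (n : ℝ) ^ d * (1 / ((n : ℝ) ^ d * (n : ℝ) ^ 2)) := by gcongr
    _ = _ := by field_simp

/-- Logarithm of the number of moment classes. -/
theorem log_card_momentClass_le (d : ℕ) {n : ℕ} (hn : 2 ≤ n) (k : ℕ) :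
    Real.log (((2 * n ^ ((12 * d + 23) * d + 5 * d + 8) + 1 : ℕ) : ℝ)
        ^ (k * ((12 * d + 22) * Nat.clog 2 n) ^ d))
      ≤ ((12 * d + 23) * d + 5 * d + 10) * (3 * (12 * d + 22)) ^ d * k
        * Real.log n ^ (d + 1) := by
  have hN : (2 : ℝ) ≤ n := by exact_mod_cast hn
  have hlog : 0 ≤ Real.log n := Real.log_nonneg (by linarith)
  have h1 : ((2 * n ^ ((12 * d + 23) * d + 5 * d + 8) + 1 : ℕ) : ℝ)
      ≤ (n : ℝ) ^ ((12 * d + 23) * d + 5 * d + 10) := by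
    push_cast
    generalize hq : (12 * d + 23) * d + 5 * d + 8 = q
    have h1 : (1 : ℝ) ≤ (n : ℝ) ^ q := one_le_pow₀ (by linarith)
    rw [show (12 * d + 23) * d + 5 * d + 10 = q + 2 by omega, pow_add]
    have h2 : (n : ℝ) ^ q * 4 ≤ (n : ℝ) ^ q * (n : ℝ) ^ 2 := by
      gcongr
      nlinarith
    linarith
  have h2 : Real.log ((2 * n ^ ((12 * d + 23) * d + 5 * d + 8) + 1 : ℕ) : ℝ)
      ≤ ((12 * d + 23) * d + 5 * d + 10) * Real.log n := by
    refine (Real.log_le_log (by positivity) h1).trans (le_of_eq ?_)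
    rw [Real.log_pow]
    push_cast; ring
  rw [Real.log_pow]
  calc _ ≤ ((k * ((12 * d + 22) * Nat.clog 2 n) ^ d : ℕ) : ℝ)
        * (((12 * d + 23) * d + 5 * d + 10) * Real.log n) := by gcongr
    _ ≤ (k * ((12 * d + 22) * (3 * Real.log n)) ^ d)
        * (((12 * d + 23) * d + 5 * d + 10) * Real.log n) := by
        push_cast
        gcongr
        exact natClog_two_le hn
    _ = _ := by
        rw [show (12 * (d : ℝ) + 22) * (3 * Real.log n) = 3 * (12 * d + 22) * Real.log n by ring,
          mul_pow, pow_succ]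
        ring

end GaussianNPMLE

/-! ### Assembly -/

theorem theorem2p3 (d : ℕ) (hd : 1 ≤ d) :
    ∃ C : ℝ, 0 < C ∧
      ∀ (n : ℕ), 2 ≤ n →
      ∀ (G : Fin n → Measure (EuclideanSpace ℝ (Fin d))), (∀ i, IsProbabilityMeasure (G i)) →
      ∀ (Ω : Type*) (_ : MeasurableSpace Ω) (P : Measure Ω), IsProbabilityMeasure P →
      ∀ (X : Fin n → Ω → EuclideanSpace ℝ (Fin d)),
        (∀ i, Measurable (X i)) →
        iIndepFun X P →
        (∀ i, P.map (X i) = GaussianNPMLE.mixtureLaw (G i)) →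
      ∀ (fhat : Ω → EuclideanSpace ℝ (Fin d) → ℝ),
        (∀ ω, GaussianNPMLE.IsNPMLE (fun i => X i ω) (fhat ω)) →
      ∀ (k : ℕ) (S : Finset (EuclideanSpace ℝ (Fin d))), S.card = k →
        GaussianNPMLE.averageMeasure G ((S : Set (EuclideanSpace ℝ (Fin d)))ᶜ) = 0 →
        ∫⁻ ω, GaussianNPMLE.hellingerSq (fhat ω)
            (GaussianNPMLE.mixtureDensity (GaussianNPMLE.averageMeasure G)) ∂P
          ≤ ENNReal.ofReal (C * ((k : ℝ) / (n : ℝ)) * Real.log (n : ℝ) ^ (d + 1)) := by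
  set c : ℝ := ((12 * d + 23) * d + 5 * d + 10) * (3 * (12 * d + 22)) ^ d
  -- `2c` comes from the class count. The rest absorbs `2 log n + 6`, since `2 log n` and 1 are both
  -- at most `(2 log n)^{d+1}`.
  refine ⟨2 * c + 7 * 2 ^ (d + 1), by positivity, ?_⟩
  intro n hn G hG Ω _ P _ X hX hind hlaw fhat hf k S hSk hS
  have : NeZero n := ⟨by omega⟩
  have hN : (2 : ℝ) ≤ n := by exact_mod_cast hn
  have hN0 : (0 : ℝ) < n := by linarith
  have hlog : 1 / 2 ≤ Real.log n := by
    have := Real.log_le_log (by norm_num) hN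
    linarith [Real.log_two_gt_d9]
  have hk : (1 : ℝ) ≤ k := by
    rcases Nat.eq_zero_or_pos k with h0 | h0
    · rw [h0, Finset.card_eq_zero] at hSk
      simp [hSk] at hS
    · exact_mod_cast h0
  have hpow : 2 * Real.log n ≤ 2 ^ (d + 1) * Real.log n ^ (d + 1) := by
    rw [← mul_pow]
    exact le_self_pow₀ (by linarith) (by omega)
  have hc0 : 0 ≤ c := by positivity
  rcases le_or_gt k n with hkn | hkn
  · set q := (12 * d + 23) * d + 5 * d + 8
    set m := (12 * d + 22) * Nat.clog 2 n
    set N : ℝ := ((2 * n ^ q + 1 : ℕ) : ℝ) ^ (k * m ^ d)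
    have hNpos : 0 < N := by positivity
    -- Chosen so that the number of classes times `exp(1 - nτ/2)` is at most `1/n`.
    set τ : ℝ := 2 * (c * k * Real.log n ^ (d + 1) + Real.log n + 1) / n with hτ
    have hτ0 : 0 ≤ τ := by positivity
    refine (GaussianNPMLE.lintegral_hellingerSq_isNPMLE_le (m := m) (K := n ^ q) (τ := τ) G hX hind
      hlaw hf S (by positivity) (by positivity) hτ0
      (GaussianNPMLE.volume_nearSet_log_le hn S (hSk ▸ hkn))
      (GaussianNPMLE.approximation_error_le d hn)).trans ?_
    have h1 : ∑ i, GaussianNPMLE.mixtureLaw (G i)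
        (GaussianNPMLE.nearSet S (4 * (d + 2) * Real.log n))ᶜ ≤ ENNReal.ofReal (1 / n) := by
      refine (Finset.sum_le_card_nsmul _ _ _ fun i _ =>
        GaussianNPMLE.mixtureLaw_compl_nearSet_log_le hn S (G i)
          (GaussianNPMLE.measure_eq_zero_of_averageMeasure G hS i)).trans (le_of_eq ?_)
      rw [Finset.card_univ, Fintype.card_fin, nsmul_eq_mul, ← ENNReal.ofReal_natCast,
        ← ENNReal.ofReal_mul (by positivity)]
      congr 1
      field_simp
    have h2 : ((2 * n ^ q + 1 : ℕ) : ENNReal) ^ (S.card * m ^ d)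
        * ENNReal.ofReal (Real.exp (1 - n * τ / 2)) ≤ ENNReal.ofReal (1 / n) := by
      rw [hSk, ← ENNReal.ofReal_natCast, ← ENNReal.ofReal_pow (by positivity),
        ← ENNReal.ofReal_mul (by positivity)]
      refine ENNReal.ofReal_le_ofReal ?_
      have hlN := GaussianNPMLE.log_card_momentClass_le d hn k
      calc N * Real.exp (1 - n * τ / 2) = Real.exp (Real.log N + (1 - n * τ / 2)) := by
            rw [Real.exp_add, Real.exp_log hNpos]
        _ ≤ Real.exp (-Real.log n) := by
            refine Real.exp_le_exp.2 ?_
            have : n * τ / 2 = c * k * Real.log n ^ (d + 1) + Real.log n + 1 := by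
              rw [hτ]; field_simp
            rw [this]
            linarith
        _ = 1 / n := by rw [Real.exp_neg, Real.exp_log hN0, one_div]
    refine (add_le_add_right (mul_le_mul_right (add_le_add h2 h1) 2) _).trans ?_
    rw [← ENNReal.ofReal_add (by positivity) (by positivity), ← ENNReal.ofReal_ofNat,
      ← ENNReal.ofReal_mul (by norm_num), ← ENNReal.ofReal_add hτ0 (by positivity)]
    refine ENNReal.ofReal_le_ofReal ?_
    have h3 : 2 ^ (d + 1) * Real.log n ^ (d + 1) ≤ k * (2 ^ (d + 1) * Real.log n ^ (d + 1)) :=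
      le_mul_of_one_le_left (by positivity) hk
    calc τ + 2 * (1 / n + 1 / n) = (2 * c * k * Real.log n ^ (d + 1) + 2 * Real.log n + 6) / n := by
          rw [hτ]; field_simp; ring
      _ ≤ (2 * c * k * Real.log n ^ (d + 1)
          + 7 * (k * (2 ^ (d + 1) * Real.log n ^ (d + 1)))) / n := by
          refine div_le_div_of_nonneg_right ?_ hN0.le
          linarith
      _ = _ := by ring
  -- For `k > n` the trivial bound 2 on the loss suffices.
  · have hb : ∀ ω, GaussianNPMLE.hellingerSq (fhat ω)
        (GaussianNPMLE.mixtureDensity (GaussianNPMLE.averageMeasure G)) ≤ 2 := by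
      intro ω
      obtain ⟨H, hH, hfH⟩ := (hf ω).1
      rw [hfH]
      exact GaussianNPMLE.hellingerSq_le_two H _
    refine (lintegral_mono hb).trans ?_
    rw [lintegral_const, measure_univ, mul_one, ← ENNReal.ofReal_ofNat]
    refine ENNReal.ofReal_le_ofReal ?_
    have hkn' : 1 ≤ (k : ℝ) / n := by
      rw [one_le_div hN0]
      exact_mod_cast hkn.le
    have hl : 0 ≤ Real.log n ^ (d + 1) := by positivity
    calc (2 : ℝ) ≤ 7 * (2 ^ (d + 1) * Real.log n ^ (d + 1)) := by linarith
      _ ≤ (2 * c + 7 * 2 ^ (d + 1)) * 1 * Real.log n ^ (d + 1) := by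
          nlinarith [mul_nonneg hc0 hl]
      _ ≤ _ := by gcongr
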